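/- **Orders of growth.** Let $\mathcal O$ be the set of non-decreasing sequences $a:\{1,2,\dots\}\to[0,\infty)$. Write $a\approx b$ if there are $c_1,c_2\in(0,\infty)$ with $c_1a(n)\le b(n)\le c_2a(n)$ for all $n$. Let $\mathbb O=\mathcal O/{\approx}$, let $[a(n)]$ be the class of $a$, and order $\mathbb O$ by $[a(n)]\le[b(n)]$ if and only if there is $C>0$ with $a(n)\le C\,b(n)$ for all $n$. Let $\overline{\mathbb O}\supset\mathbb O$ be the Dedekind–MacNeille completion of $\mathbb O$. **Generalized entropy.** Let $(M,d)$ be a compact metric space and $f:M\to M$ continuous. For $n\ge1$ and $\varepsilon>0$ let $B(x,n,\varepsilon)=\{y\in M:\max_{0\le k\le n-1}d(f^k(x),f^k(y))<\varepsilon\}$, and let $g_{f,\varepsilon}(n)$ be the smallest cardinality of a finite set $G\subset M$ with $M=\bigcup_{x\in G}B(x,n,\varepsilon)$. The generalized entropy of $f$ is $o(f)=\sup\{[g_{f,\varepsilon}(n)]:\varepsilon>0\}\in\overline{\mathbb O}$. **Codings.** Let $f:M\to M$ be a homeomorphism. Its non-wandering set $\Omega(f)$ is the set of points $x$ such that for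 every neighborhood $U$ of $x$ there is $n\ge1$ with $f^n(U)\cap U\neq\emptyset$. For a finite family $\mathcal F$ of non-empty subsets of $M\setminus\Omega(f)$, put $\infty_{\mathcal F}=M\setminus\bigcup\mathcal F$ and let $c_{f,\mathcal F}(n)$ be the number of words $(w_0,\dots,w_{n-1})$ with letters in $\mathcal F\cup\{\infty_{\mathcal F}\}$ for which there is a point $x\in M$ with $f^i(x)\in w_i$ for all $0\le i\le n-1$. **The families $\Sigma$ and $\Sigma_\delta$.** A set $Y$ is wandering if $f^n(Y)\cap Y=\emptyset$ for every $n\ge1$; it is a compact neighborhood if it is compact and is the closure of an open set. Sets $Y_1,\dots,Y_L$ are mutually singular if for every $N>0$ there are a point $x$ and times $n_1,\dots,n_L\in\mathbb Z$ with $f^{n_i}(x)\in Y_i$ for all $i$ and $|n_i-n_j|>N$ for all $i\ne j$. Let $\Sigma$ be the set of all finite families (the empty family included) of non-empty wandering compact neighborhoods contained in $M\setminus\Omega(f)$ that are mutually singular, and for $\delta>0$ let $\Sigma_\delta$ be the set of those $\mathcal F\in\Sigma$ all of whose elements have diameter smaller than $\delta$. **Theorem.** Let $M$ be a compact metric space and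 $f:M\to M$ a homeomorphism such that $\Omega(f)$ is finite. Then, in $\overline{\mathbb O}$, $$o(f)=\sup\{[c_{f,\mathcal F}(n)]:\mathcal F\in\Sigma\},$$ and for every $\delta>0$ also $$o(f)=\sup\{[c_{f,\mathcal F}(n)]:\mathcal F\in\Sigma_\delta\}.$$ -/

import Mathlib

open Topology Set
open scoped NNReal

noncomputable section

/-! ### Orders of growth and their Dedekind–MacNeille completion -/

/-- Two non-decreasing sequences `a, b : {1, 2, …} → [0, ∞)` have the same order of growth if
`c₁ a(n) ≤ b(n) ≤ c₂ a(n)` for all `n`, for some positive constants `c₁, c₂`. -/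
def growthSetoid : Setoid (ℕ+ →o ℝ≥0) where
  r a b := ∃ c₁ c₂ : ℝ≥0, 0 < c₁ ∧ 0 < c₂ ∧ ∀ n, c₁ * a n ≤ b n ∧ b n ≤ c₂ * a n
  iseqv :=
    { refl := fun a => ⟨1, 1, one_pos, one_pos, fun n => by simp⟩
      symm := by
        rintro a b ⟨c₁, c₂, h₁, h₂, h⟩
        refine ⟨c₂⁻¹, c₁⁻¹, inv_pos.2 h₂, inv_pos.2 h₁, fun n => ⟨?_, ?_⟩⟩
        · exact (inv_mul_le_iff₀ h₂).2 (h n).2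
        · exact (le_inv_mul_iff₀ h₁).2 (h n).1
      trans := by
        rintro a b c ⟨c₁, c₂, h₁, h₂, h⟩ ⟨d₁, d₂, k₁, k₂, k⟩
        refine ⟨d₁ * c₁, d₂ * c₂, mul_pos k₁ h₁, mul_pos k₂ h₂, fun n => ⟨?_, ?_⟩⟩
        · rw [mul_assoc]
          exact (mul_le_mul_right (h n).1 d₁).trans (k n).1
        · rw [mul_assoc]
          exact (k n).2.trans (mul_le_mul_right (h n).2 d₂) }

/-- The space of orders of growth. -/
def OrderOfGrowth : Type := Quotient growthSetoid

/-- The order of growth `[a(n)]` of a non-decreasing sequence. -/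
def OrderOfGrowth.mk (a : ℕ+ →o ℝ≥0) : OrderOfGrowth := Quotient.mk growthSetoid a

/-- `[a(n)] ≤ [b(n)]` if there is `C > 0` with `a(n) ≤ C b(n)` for all `n`. -/
instance : LE OrderOfGrowth where
  le := Quotient.lift₂ (s₁ := growthSetoid) (s₂ := growthSetoid)
    (fun a b : ℕ+ →o ℝ≥0 => ∃ C : ℝ≥0, 0 < C ∧ ∀ n, a n ≤ C * b n) (by
      have key : ∀ a b a' b' : ℕ+ →o ℝ≥0, growthSetoid.r a a' → growthSetoid.r b b' →
          (∃ C : ℝ≥0, 0 < C ∧ ∀ n, a n ≤ C * b n) → ∃ C : ℝ≥0, 0 < C ∧ ∀ n, a' n ≤ C * b' n := by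
        rintro a b a' b' ⟨_, c₂, _, h₂, h⟩ hb ⟨C, hC, H⟩
        obtain ⟨_, d₂, _, k₂, k⟩ := growthSetoid.iseqv.symm hb
        refine ⟨c₂ * (C * d₂), mul_pos h₂ (mul_pos hC k₂), fun n => (h n).2.trans ?_⟩
        rw [mul_assoc, mul_assoc]
        exact mul_le_mul_right ((H n).trans (mul_le_mul_right (k n).2 C)) c₂
      intro a b a' b' ha hb
      exact propext ⟨key a b a' b' ha hb,
        key a' b' a b (growthSetoid.iseqv.symm ha) (growthSetoid.iseqv.symm hb)⟩)

theorem OrderOfGrowth.mk_le_mk (a b : ℕ+ →o ℝ≥0) :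
    OrderOfGrowth.mk a ≤ OrderOfGrowth.mk b ↔ ∃ C : ℝ≥0, 0 < C ∧ ∀ n, a n ≤ C * b n :=
  Iff.rfl

instance : PartialOrder OrderOfGrowth where
  le_refl a := by
    induction a using Quotient.inductionOn
    exact ⟨1, one_pos, fun n => by simp⟩
  le_trans a b c := by
    induction a using Quotient.inductionOn
    induction b using Quotient.inductionOn
    induction c using Quotient.inductionOn
    rintro ⟨C, hC, h⟩ ⟨D, hD, k⟩
    refine ⟨C * D, mul_pos hC hD, fun n => (h n).trans ?_⟩
    rw [mul_assoc]
    exact mul_le_mul_right (k n) C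
  le_antisymm a b := by
    induction a using Quotient.inductionOn
    induction b using Quotient.inductionOn
    rintro ⟨C, hC, h⟩ ⟨D, hD, k⟩
    refine Quotient.sound ⟨C⁻¹, D, inv_pos.2 hC, hD, fun n => ⟨?_, k n⟩⟩
    exact (inv_mul_le_iff₀ hC).2 (h n)

/-- The complete set of orders of growth. -/
abbrev CompleteOrderOfGrowth : Type := DedekindCut OrderOfGrowth

/-- The class `[a(n)]`, seen in the complete set of orders of growth. -/
def growthClass (a : ℕ+ →o ℝ≥0) : CompleteOrderOfGrowth :=
  DedekindCut.principal (OrderOfGrowth.mk a)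

/-! ### Generalized entropy -/

section Entropy

variable {M : Type*} [MetricSpace M]

/-- The dynamical ball `B(x, n, ε)`: the points `y` with
`max {d(f^k(x), f^k(y)) : 0 ≤ k ≤ n - 1} < ε`. -/
def dynBall (f : M → M) (x : M) (n : ℕ+) (ε : ℝ) : Set M :=
  {y | ∀ k < (n : ℕ), dist (f^[k] x) (f^[k] y) < ε}

/-- `G` is an `(n, ε)`-generator if the balls `B(x, n, ε)`, `x ∈ G`, cover `M`. -/
def IsGenerator (f : M → M) (n : ℕ+) (ε : ℝ) (G : Finset M) : Prop :=
  (⋃ x ∈ G, dynBall f x n ε) = univ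

/-- The smallest cardinality `g_{f,ε}(n)` of a finite `(n, ε)`-generator. -/
def minGenerator (f : M → M) (ε : ℝ) (n : ℕ+) : ℕ :=
  sInf {m | ∃ G : Finset M, IsGenerator f n ε G ∧ G.card = m}

theorem exists_isGenerator [CompactSpace M] {f : M → M} (hf : Continuous f) {ε : ℝ} (hε : 0 < ε)
    (n : ℕ+) : ∃ G : Finset M, IsGenerator f n ε G := by
  have hopen : ∀ x : M, dynBall f x n ε ∈ 𝓝 x := by
    intro x
    have : dynBall f x n ε = ⋂ k ∈ Finset.range n, {y | dist (f^[k] x) (f^[k] y) < ε} := by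
      ext y; simp [dynBall]
    rw [this]
    refine (Filter.biInter_finset_mem _).2 fun k _ => ?_
    refine (isOpen_lt ?_ continuous_const).mem_nhds (by simpa using hε)
    exact continuous_const.dist (hf.iterate k)
  obtain ⟨G, -, hG⟩ := isCompact_univ.elim_nhds_subcover (fun x => dynBall f x n ε)
    (fun x _ => hopen x)
  exact ⟨G, univ_subset_iff.1 hG⟩

theorem minGenerator_mono [CompactSpace M] {f : M → M} (hf : Continuous f) {ε : ℝ} (hε : 0 < ε) :
    Monotone (minGenerator f ε) := by
  intro m n hmn
  obtain ⟨G, hG, hcard⟩ : minGenerator f ε n ∈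
      {m | ∃ G : Finset M, IsGenerator f n ε G ∧ G.card = m} := by
    obtain ⟨G, hG⟩ := exists_isGenerator hf hε n
    exact Nat.sInf_mem ⟨_, G, hG, rfl⟩
  refine Nat.sInf_le ⟨G, ?_, hcard⟩
  refine univ_subset_iff.1 (hG.symm.subset.trans ?_)
  exact iUnion₂_mono fun x _ y hy k hk => hy k (hk.trans_le hmn)

/-- The sequence `g_{f,ε}(n)` as a non-decreasing sequence in `[0, ∞)`. -/
def generatorSeq [CompactSpace M] (f : M → M) (hf : Continuous f) (ε : ℝ) (hε : 0 < ε) :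
    ℕ+ →o ℝ≥0 where
  toFun n := (minGenerator f ε n : ℝ≥0)
  monotone' _ _ h := Nat.cast_le.2 (minGenerator_mono hf hε h)

/-- The generalized entropy `o(f)`, the supremum of the classes `[g_{f,ε}(n)]`, `ε > 0`. -/
def generalizedEntropy [CompactSpace M] (f : M → M) (hf : Continuous f) : CompleteOrderOfGrowth :=
  sSup {o | ∃ (ε : ℝ) (hε : 0 < ε), o = growthClass (generatorSeq f hf ε hε)}

end Entropy

/-! ### Coding of orbits -/

section Coding

variable {M : Type*}

/-- The letters relative to `F`: the elements of `F` and the complement `∞_F` of their union. -/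
def codingLetters (F : Finset (Set M)) : Set (Set M) :=
  insert (⋃₀ (F : Set (Set M)))ᶜ (F : Set (Set M))

/-- `A_n(f, F)`: all words `w` of length `n` in the letters relative to `F` that code the orbit
`(x, f(x), …, f^{n-1}(x))` of some point `x`. -/
def codings (f : M → M) (F : Finset (Set M)) (n : ℕ+) : Set (Fin n → Set M) :=
  {w | (∀ i, w i ∈ codingLetters F) ∧ ∃ x : M, ∀ i, f^[(i : ℕ)] x ∈ w i}

theorem codings_finite (f : M → M) (F : Finset (Set M)) (n : ℕ+) : (codings f F n).Finite := by
  have h : (codingLetters F).Finite := F.finite_toSet.insert _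
  refine (Set.Finite.pi (fun _ : Fin n => h)).subset ?_
  intro w hw i _
  exact hw.1 i

/-- The number `c_{f,F}(n)` of codings of length `n`. -/
def codingCount (f : M → M) (F : Finset (Set M)) (n : ℕ+) : ℕ := (codings f F n).ncard

theorem exists_codingLetter (F : Finset (Set M)) (x : M) : ∃ Y ∈ codingLetters F, x ∈ Y := by
  by_cases hx : x ∈ ⋃₀ (F : Set (Set M))
  · obtain ⟨Y, hY, hxY⟩ := hx
    exact ⟨Y, mem_insert_of_mem _ hY, hxY⟩
  · exact ⟨_, mem_insert _ _, hx⟩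

theorem codingCount_mono (f : M → M) (F : Finset (Set M)) : Monotone (codingCount f F) := by
  intro m n hmn
  have hmn' : (m : ℕ) ≤ n := hmn
  refine (ncard_le_ncard (t := (fun w : Fin n → Set M => w ∘ Fin.castLE hmn') '' codings f F n)
    ?_ ((codings_finite f F n).image _)).trans (ncard_image_le (codings_finite f F n))
  rintro w ⟨hw, x, hx⟩
  choose l hl hl' using exists_codingLetter F
  refine ⟨fun i => if h : (i : ℕ) < m then w ⟨i, h⟩ else l (f^[(i : ℕ)] x), ⟨fun i => ?_, x,
    fun i => ?_⟩, ?_⟩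
  · by_cases h : (i : ℕ) < m
    · simpa [h] using hw _
    · simpa [h] using hl _
  · by_cases h : (i : ℕ) < m
    · simpa [h] using hx ⟨i, h⟩
    · simpa [h] using hl' _
  · funext i
    simp

/-- The sequence `c_{f,F}(n)` as a non-decreasing sequence in `[0, ∞)`. -/
def codingSeq (f : M → M) (F : Finset (Set M)) : ℕ+ →o ℝ≥0 where
  toFun n := (codingCount f F n : ℝ≥0)
  monotone' _ _ h := Nat.cast_le.2 (codingCount_mono f F h)

end Coding

/-! ### Mutually singular families of wandering compact neighborhoods -/

section Families

variable {M : Type*} [MetricSpace M]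

/-- The non-wandering set `Ω(f)`. -/
def nonwanderingSet (f : M → M) : Set M :=
  {x | ∀ U ∈ 𝓝 x, ∃ n : ℕ, 1 ≤ n ∧ (f^[n] '' U ∩ U).Nonempty}

/-- A set `Y` is wandering if `f^n(Y) ∩ Y = ∅` for every `n ≥ 1`. -/
def IsWanderingSet (f : M → M) (Y : Set M) : Prop :=
  ∀ n : ℕ, 1 ≤ n → f^[n] '' Y ∩ Y = ∅

/-- A compact neighborhood: a compact set that is the closure of an open set. -/
def IsCompactNeighborhood (Y : Set M) : Prop :=
  IsCompact Y ∧ ∃ U : Set M, IsOpen U ∧ Y = closure U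

/-- The members of `F` are mutually singular: for every `N`, some orbit visits all of them, at
times that are pairwise more than `N` apart. -/
def MutuallySingular (f : M ≃ₜ M) (F : Finset (Set M)) : Prop :=
  ∀ N : ℕ, ∃ (x : M) (t : Set M → ℤ), (∀ Y ∈ F, (f ^ t Y) x ∈ Y) ∧
    ∀ Y ∈ F, ∀ Z ∈ F, Y ≠ Z → (N : ℤ) < |t Y - t Z|

/-- `Σ`: the finite families (the empty family included) of non-empty wandering compact
neighborhoods contained in `M ∖ Ω(f)` that are mutually singular. -/
def singularFamilies (f : M ≃ₜ M) : Set (Finset (Set M)) :=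
  {F | (∀ Y ∈ F, Y.Nonempty ∧ Y ⊆ (nonwanderingSet f)ᶜ ∧ IsWanderingSet f Y ∧
    IsCompactNeighborhood Y) ∧ MutuallySingular f F}

/-- `Σ_δ`: the families in `Σ` all of whose members have diameter smaller than `δ`. -/
def smallSingularFamilies (f : M ≃ₜ M) (δ : ℝ) : Set (Finset (Set M)) :=
  {F ∈ singularFamilies f | ∀ Y ∈ F, Metric.diam Y < δ}

end Families

end

/-! Codings are dominated by generators because a wandering ball is visited at most once by an
orbit. The union of the family is compact and avoids the non-wandering set, so finitely many
wandering balls cover it. An ε-approximation of an orbit then tells when each ball is visited, and a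
word is recovered up to finitely many choices (`exists_pos_codingCount_le`).

Conversely, when Ω(f) is finite, finitely many small wandering compact neighborhoods cover the
complement of small balls around Ω(f). Knowing when an orbit meets each neighborhood, and near which
point of Ω(f) it starts, determines it up to ε: in one step it cannot jump from one small ball to
another without the approximating orbit doing the same (`minGenerator_le_sum_visitTimes`). Vectors
of visit times are in turn counted by codings. If a family is not mutually singular, one visit time
is always within bounded distance of another, so a member can be dropped at the cost of a constant;
induction leaves mutually singular families only (`exists_ncard_visitTimes_le_sum_codingCount`). The
resulting finite sum is absorbed by the supremum (`growthClass_le_of_le_sum`). -/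

/-! ### Generators from labels, and finite sums in the completion -/

-- One representative point per realized label gives a generator.
open Classical in
theorem minGenerator_le_card {M κ : Type*} [MetricSpace M] {f : M → M} {ε : ℝ} {n : ℕ+}
    (A : Finset κ) (R : M → κ → Prop) (hR : ∀ x, ∃ k ∈ A, R x k)
    (hclose : ∀ x y k, R x k → R y k → y ∈ dynBall f x n ε) :
    minGenerator f ε n ≤ A.card := by
  let G : Finset M := A.biUnion fun k => if h : ∃ x, R x k then {h.choose} else ∅
  have hG : IsGenerator f n ε G := by
    refine eq_univ_of_forall fun y => ?_
    obtain ⟨k, hk, hyk⟩ := hR y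
    have h : ∃ x, R x k := ⟨y, hyk⟩
    refine mem_iUnion₂.2 ⟨h.choose, ?_, hclose _ _ k h.choose_spec hyk⟩
    refine Finset.mem_biUnion.2 ⟨k, hk, ?_⟩
    simp only [dif_pos h, Finset.mem_singleton]
  have hcard : G.card ≤ A.card := by
    refine Finset.card_biUnion_le.trans ((Finset.sum_le_card_nsmul A _ 1 fun k _ => ?_).trans
      (by simp))
    split_ifs <;> simp
  exact (Nat.sInf_le (show G.card ∈ {m | ∃ G : Finset M, IsGenerator f n ε G ∧ G.card = m} from
    ⟨G, hG, rfl⟩)).trans hcard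

theorem exists_isGenerator_card_eq {M : Type*} [MetricSpace M] [CompactSpace M] {f : M → M}
    (hf : Continuous f) {ε : ℝ} (hε : 0 < ε) (n : ℕ+) :
    ∃ G : Finset M, IsGenerator f n ε G ∧ G.card = minGenerator f ε n := by
  obtain ⟨G, hG⟩ := exists_isGenerator hf hε n
  exact Nat.sInf_mem (s := {m | ∃ G : Finset M, IsGenerator f n ε G ∧ G.card = m}) ⟨_, G, hG, rfl⟩

/-- An element of the completion is determined by the orders of growth above it, so it suffices to
compare with a single sequence `u`. A sequence that dominates each `b i` dominates their finite sum.
-/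
theorem growthClass_le_of_le_sum {ι : Type*} {a : ℕ+ →o ℝ≥0} (J : Finset ι)
    (b : ι → ℕ+ →o ℝ≥0) (C : ℝ≥0) (h : ∀ n, a n ≤ C * ∑ i ∈ J, b i n)
    {c : CompleteOrderOfGrowth} (hc : ∀ i ∈ J, growthClass (b i) ≤ c) : growthClass a ≤ c := by
  rw [growthClass, DedekindCut.principal_le_iff, ← DedekindCut.lowerBounds_right]
  intro u hu
  have hu' : ∀ i ∈ J, OrderOfGrowth.mk (b i) ≤ u := by
    intro i hi
    have := hc i hi
    rw [growthClass, DedekindCut.principal_le_iff, ← DedekindCut.lowerBounds_right] at this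
    exact this hu
  induction u using Quotient.inductionOn with
  | h u =>
    replace hu' : ∀ i ∈ J, ∃ D : ℝ≥0, 0 < D ∧ ∀ n, b i n ≤ D * u n := hu'
    choose! D _ hD using hu'
    refine (OrderOfGrowth.mk_le_mk a u).2 ⟨C * ∑ i ∈ J, D i + 1, by positivity, fun n => ?_⟩
    calc a n ≤ C * ∑ i ∈ J, b i n := h n
      _ ≤ C * ∑ i ∈ J, D i * u n := by gcongr with i hi; exact hD i hi n
      _ = (C * ∑ i ∈ J, D i) * u n := by rw [← Finset.sum_mul, mul_assoc]
      _ ≤ (C * ∑ i ∈ J, D i + 1) * u n := by gcongr; exact le_self_add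

/-! ### Wandering sets and visit times -/

theorem IsWanderingSet.mono {M : Type*} {f : M → M} {Y Z : Set M}
    (hZ : IsWanderingSet f Z) (h : Y ⊆ Z) : IsWanderingSet f Y := fun n hn =>
  subset_empty_iff.1 ((inter_subset_inter (image_mono h) h).trans (hZ n hn).subset)

theorem IsWanderingSet.eq_of_mem {M : Type*} {f : M → M} {Y : Set M}
    (hY : IsWanderingSet f Y) {x : M} {i j : ℕ} (hi : f^[i] x ∈ Y) (hj : f^[j] x ∈ Y) :
    i = j := by
  have key : ∀ i j : ℕ, f^[i] x ∈ Y → f^[j] x ∈ Y → ¬ i < j := by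
    intro i j hi hj hij
    have hmem : f^[j] x ∈ f^[j - i] '' Y ∩ Y := by
      refine ⟨⟨f^[i] x, hi, ?_⟩, hj⟩
      rw [← Function.iterate_add_apply, Nat.sub_add_cancel hij.le]
    rw [hY (j - i) (by omega)] at hmem
    exact hmem
  exact le_antisymm (not_lt.1 (key j i hj hi)) (not_lt.1 (key i j hi hj))

/-- The possible times in `[0, n)` at which one orbit visits every member of `S`. -/
def visitTimes {M : Type*} (f : M → M) (S : Finset (Set M)) (n : ℕ) : Set (S → Fin n) :=
  {t | ∃ x, ∀ Y : S, f^[(t Y : ℕ)] x ∈ (Y : Set M)}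

/-- A letter of `S` occurs at most once in a word, so the word reveals its time. Members of `S` may
overlap, so the letter at the visit time of `Y` can be another member; the factor counts the maps `S
→ S` recording which. -/
theorem ncard_visitTimes_le_codingCount {M : Type*} {f : M → M} (S : Finset (Set M))
    (hS : ∀ Y ∈ S, IsWanderingSet f Y) :
    ∃ C : ℕ, ∀ n : ℕ+, (visitTimes f S n).ncard ≤ C * codingCount f S n := by
  classical
  refine ⟨Nat.card (S → S), fun n => ?_⟩
  rcases (visitTimes f S n).eq_empty_or_nonempty with hempty | ⟨_, x₀, -⟩
  · simp [hempty]
  have : Nonempty M := ⟨x₀⟩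
  choose l hl hl' using exists_codingLetter S
  choose! z hz using fun (t : S → Fin n) (ht : t ∈ visitTimes f S n) => ht
  let w : (S → Fin n) → Fin n → Set M := fun t i => l (f^[(i : ℕ)] (z t))
  have hw : ∀ t, w t ∈ codings f S n := fun t => ⟨fun i => hl _, z t, fun i => hl' _⟩
  have hwS : ∀ t ∈ visitTimes f S n, ∀ Y, w t (t Y) ∈ S := by
    intro t ht Y
    refine (hl (f^[(t Y : ℕ)] (z t))).resolve_left fun h => ?_
    have := hl' (f^[(t Y : ℕ)] (z t))
    rw [h] at this
    exact this ⟨Y, Y.2, hz t ht Y⟩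
  -- The fallback value `Y` is never reached on `visitTimes f S n`, by `hwS`.
  let φ : (S → Fin n) → S → S := fun t Y => if h : w t (t Y) ∈ S then ⟨_, h⟩ else Y
  have hφ : ∀ t ∈ visitTimes f S n, ∀ Y, (φ t Y : Set M) = w t (t Y) := by
    intro t ht Y
    simp only [φ, dif_pos (hwS t ht Y)]
  have hinj : InjOn (fun t => (φ t, w t)) (visitTimes f S n) := by
    intro t ht t' ht' h
    simp only [Prod.mk.injEq] at h
    funext Y
    have h1 : w t (t Y) = w t (t' Y) := by
      rw [← hφ t ht Y, h.1, hφ t' ht' Y, h.2]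
    have h2 : f^[(t Y : ℕ)] (z t) ∈ w t (t Y) := hl' _
    have h3 : f^[(t' Y : ℕ)] (z t) ∈ w t (t' Y) := hl' _
    rw [← h1] at h3
    exact Fin.ext ((hS _ (hwS t ht Y)).eq_of_mem h2 h3)
  calc (visitTimes f S n).ncard
      ≤ ((univ : Set (S → S)) ×ˢ codings f S n).ncard :=
        ncard_le_ncard_of_injOn _ (fun t _ => ⟨mem_univ _, hw t⟩) hinj
          (finite_univ.prod (codings_finite f S n))
    _ = Nat.card (S → S) * codingCount f S n := by
        rw [ncard_prod, ncard_univ, codingCount]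

section Wandering

variable {M : Type*} [MetricSpace M]

/-! ### Codings are bounded by generators -/

theorem exists_isWanderingSet_ball {f : M → M} {x : M} (hx : x ∉ nonwanderingSet f) :
    ∃ s > 0, IsWanderingSet f (Metric.ball x s) := by
  simp only [nonwanderingSet, mem_ofPred_eq, not_forall, not_exists, not_and,
    not_nonempty_iff_eq_empty] at hx
  obtain ⟨U, hU, h⟩ := hx
  obtain ⟨s, hs, hsU⟩ := Metric.mem_nhds_iff.1 hU
  exact ⟨s, hs, IsWanderingSet.mono h hsU⟩

theorem IsWanderingSet.subset_compl_nonwanderingSet {f : M → M} {U : Set M} (hU : IsOpen U)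
    (h : IsWanderingSet f U) : U ⊆ (nonwanderingSet f)ᶜ := by
  intro x hx hx'
  obtain ⟨n, hn, hne⟩ := hx' U (hU.mem_nhds hx)
  exact hne.ne_empty (h n hn)

theorem exists_pos_codingCount_le [CompactSpace M] {f : M → M} (hf : Continuous f)
    (F : Finset (Set M)) (hF : ∀ Y ∈ F, Y ⊆ (nonwanderingSet f)ᶜ ∧ IsCompact Y) :
    ∃ ε > 0, ∃ C : ℕ, ∀ n, codingCount f F n ≤ C * minGenerator f ε n := by
  classical
  have hK : IsCompact (⋃ Y ∈ F, Y) := F.isCompact_biUnion fun Y hY => (hF Y hY).2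
  have hKΩ : ∀ x ∈ ⋃ Y ∈ F, Y, x ∉ nonwanderingSet f := by
    intro x hx
    obtain ⟨Y, hY, hxY⟩ := mem_iUnion₂.1 hx
    exact (hF Y hY).1 hxY
  choose! s hs hsw using fun (x : M) (hx : x ∉ nonwanderingSet f) =>
    exists_isWanderingSet_ball hx
  obtain ⟨A, hAK, hA⟩ := hK.elim_nhds_subcover (fun x => Metric.ball x (s x / 2))
    (fun x hx => Metric.ball_mem_nhds x (half_pos (hs x (hKΩ x hx))))
  obtain ⟨δ, hδ, hδA⟩ : ∃ δ > 0, ∀ a ∈ A, δ ≤ s a / 2 := by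
    rcases A.eq_empty_or_nonempty with rfl | hne
    · exact ⟨1, one_pos, by simp⟩
    · obtain ⟨a, ha, hmin⟩ := A.exists_min_image (fun a => s a / 2) hne
      exact ⟨s a / 2, half_pos (hs a (hKΩ a (hAK a ha))), hmin⟩
  refine ⟨δ / 2, half_pos hδ, (F ×ˢ A).powerset.card, fun n => ?_⟩
  rcases (codings f F n).eq_empty_or_nonempty with hempty | ⟨_, -, x₀, -⟩
  · simp [codingCount, hempty]
  have : Nonempty M := ⟨x₀⟩
  obtain ⟨G, hG, hGcard⟩ := exists_isGenerator_card_eq hf (half_pos hδ) n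
  choose! z hz using fun (w : Fin n → Set M) (hw : w ∈ codings f F n) => hw.2
  have hcenter : ∀ x : M, ∃ c ∈ G, x ∈ dynBall f c n (δ / 2) := by
    intro x
    simpa using hG.symm.subset (mem_univ x)
  choose c hcG hc using hcenter
  -- `D w` records which pairs (letter, ball) occur along the orbit, but not when; the center `c (z
  -- w)` supplies the times.
  let D : (Fin n → Set M) → Finset (Set M × M) := fun w => (F ×ˢ A).filter fun P =>
    ∃ i, w i = P.1 ∧ f^[(i : ℕ)] (z w) ∈ Metric.ball P.2 (s P.2 / 2)
  have hstep : ∀ w ∈ codings f F n, ∀ w' ∈ codings f F n, D w = D w' → c (z w) = c (z w') →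
      ∀ i, w i ∈ F → w' i = w i := by
    intro w hw w' hw' hD hcc i hi
    obtain ⟨a, ha, hia⟩ := mem_iUnion₂.1 (hA (mem_iUnion₂.2 ⟨w i, hi, hz w hw i⟩))
    have hmem : (w i, a) ∈ D w :=
      Finset.mem_filter.2 ⟨Finset.mem_product.2 ⟨hi, ha⟩, i, rfl, hia⟩
    rw [hD] at hmem
    obtain ⟨-, j, hj, hja⟩ := Finset.mem_filter.1 hmem
    have h1 := hc (z w) j j.2
    have h2 := hc (z w') j j.2
    rw [← hcc] at h2
    have hδa := hδA a ha
    simp only [Metric.mem_ball] at hia hja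
    -- The common center keeps the two orbits within `δ ≤ s a / 2`, so a visit of one to the half
    -- ball is a visit of the other to the full wandering ball. This forces `i = j`.
    have hja' : f^[(j : ℕ)] (z w) ∈ Metric.ball a (s a) := by
      rw [Metric.mem_ball]
      have t1 := dist_triangle (f^[(j : ℕ)] (z w)) (f^[(j : ℕ)] (z w')) a
      have t2 := dist_triangle_left (f^[(j : ℕ)] (z w)) (f^[(j : ℕ)] (z w'))
        (f^[(j : ℕ)] (c (z w)))
      linarith
    have hia' : f^[(i : ℕ)] (z w) ∈ Metric.ball a (s a) := by
      rw [Metric.mem_ball]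
      linarith [hs a (hKΩ a (hAK a ha))]
    rw [Fin.ext ((hsw a (hKΩ a (hAK a ha))).eq_of_mem hia' hja')] at hj ⊢
    exact hj
  have hinj : InjOn (fun w => (D w, c (z w))) (codings f F n) := by
    intro w hw w' hw' h
    simp only [Prod.mk.injEq] at h
    funext i
    by_cases hi : w i ∈ F
    · exact (hstep w hw w' hw' h.1 h.2 i hi).symm
    by_cases hi' : w' i ∈ F
    · exact hstep w' hw' w hw h.1.symm h.2.symm i hi'
    · rw [(hw.1 i).resolve_right hi, (hw'.1 i).resolve_right hi']
  calc codingCount f F n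
      ≤ (((F ×ˢ A).powerset ×ˢ G : Finset _) : Set (Finset (Set M × M) × M)).ncard := by
        refine ncard_le_ncard_of_injOn _ (fun w hw => ?_) hinj (Finset.finite_toSet _)
        simp only [Finset.coe_product, mem_prod, Finset.mem_coe, Finset.mem_powerset]
        exact ⟨Finset.filter_subset _ _, hcG _⟩
    _ = (F ×ˢ A).powerset.card * minGenerator f (δ / 2) n := by
        rw [ncard_coe_finset, Finset.card_product, hGcard]

/-! ### Reduction to mutually singular families -/

theorem Homeomorph.zpow_natCast_apply (f : M ≃ₜ M) (n : ℕ) (x : M) :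
    (f ^ (n : ℤ)) x = f^[n] x := by
  rw [zpow_natCast]
  induction n with
  | zero => rfl
  | succ n ih => rw [pow_succ', Homeomorph.mul_apply, ih, Function.iterate_succ_apply']

theorem exists_ncard_visitTimes_le_of_not_mutuallySingular [DecidableEq (Set M)] {f : M ≃ₜ M}
    {S : Finset (Set M)} (hS : ¬ MutuallySingular f S) :
    ∃ C : ℕ, ∀ n : ℕ, (visitTimes f S n).ncard ≤
      C * ∑ Z ∈ S, (visitTimes f (S.erase Z) n).ncard := by
  simp only [MutuallySingular, not_forall, not_exists, not_and, exists_prop] at hS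
  obtain ⟨N, hN⟩ := hS
  refine ⟨S.card * (2 * N + 1), fun n => ?_⟩
  -- The times of `Z` and `Y` differ by `k - N`; the shift by `N` keeps the offset natural, in `[0,
  -- 2N]`. On such a piece the time of `Z` follows from that of `Y`.
  let E : S → S → ℕ → Set (S → Fin n) := fun Z Y k =>
    {t | t ∈ visitTimes f S n ∧ Y ≠ Z ∧ (t Z : ℕ) + N = t Y + k}
  have hcover : visitTimes f S n ⊆
      ⋃ P ∈ (Finset.univ : Finset (S × S × Fin (2 * N + 1))), E P.1 P.2.1 P.2.2 := by
    rintro t ⟨x, hx⟩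
    let τ : Set M → ℤ := fun Y => if h : Y ∈ S then ((t ⟨Y, h⟩ : ℕ) : ℤ) else 0
    have hτ : ∀ Y (h : Y ∈ S), τ Y = ((t ⟨Y, h⟩ : ℕ) : ℤ) := fun Y h => dif_pos h
    obtain ⟨Y, hY, Z, hZ, hYZ, hle⟩ := hN x τ fun Y hY => by
      rw [hτ Y hY, Homeomorph.zpow_natCast_apply]
      exact hx ⟨Y, hY⟩
    rw [hτ Y hY, hτ Z hZ, not_lt, abs_le] at hle
    refine mem_iUnion₂.2 ⟨(⟨Z, hZ⟩, ⟨Y, hY⟩,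
      ⟨(t ⟨Z, hZ⟩ : ℕ) + N - t ⟨Y, hY⟩, by omega⟩), Finset.mem_univ _, ⟨x, hx⟩, ?_, ?_⟩
    · simpa using hYZ
    · simp only
      omega
  have hpiece : ∀ Z Y k, (E Z Y k).ncard ≤ (visitTimes f (S.erase Z) n).ncard := by
    intro Z Y k
    refine ncard_le_ncard_of_injOn
      (fun t (X : S.erase (Z : Set M)) => t ⟨X, Finset.mem_of_mem_erase X.2⟩) ?_ ?_ (toFinite _)
    · rintro t ⟨⟨x, hx⟩, -⟩
      exact ⟨x, fun X => hx ⟨X, Finset.mem_of_mem_erase X.2⟩⟩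
    · rintro t ⟨-, hYZ, ht⟩ t' ⟨-, -, ht'⟩ h
      have hne : ∀ X : S, X ≠ Z → t X = t' X := fun X hX =>
        congrFun h ⟨X, Finset.mem_erase.2 ⟨fun h => hX (Subtype.ext h), X.2⟩⟩
      funext X
      by_cases hX : X = Z
      · subst hX
        have := hne Y hYZ
        rw [this] at ht
        exact Fin.ext (by omega)
      · exact hne X hX
  calc (visitTimes f S n).ncard
      ≤ (⋃ P ∈ (Finset.univ : Finset (S × S × Fin (2 * N + 1))), E P.1 P.2.1 P.2.2).ncard :=
        ncard_le_ncard hcover (toFinite _)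
    _ ≤ ∑ P : S × S × Fin (2 * N + 1), (E P.1 P.2.1 P.2.2).ncard :=
        Finset.set_ncard_biUnion_le _ _
    _ ≤ ∑ P : S × S × Fin (2 * N + 1), (visitTimes f (S.erase P.1) n).ncard :=
        Finset.sum_le_sum fun P _ => hpiece _ _ _
    _ = S.card * (2 * N + 1) * ∑ Z ∈ S, (visitTimes f (S.erase Z) n).ncard := by
        rw [Fintype.sum_prod_type]
        simp only [Finset.sum_const, Finset.card_univ, Fintype.card_prod, Fintype.card_coe,
          Fintype.card_fin, smul_eq_mul]
        rw [← Finset.mul_sum, Finset.sum_coe_sort S fun Z => (visitTimes f (S.erase Z) n).ncard]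

open Classical in
theorem exists_ncard_visitTimes_le_sum_codingCount {f : M ≃ₜ M} (S : Finset (Set M))
    (hS : ∀ Y ∈ S, IsWanderingSet f Y) :
    ∃ C : ℕ, ∀ n : ℕ+, (visitTimes f S n).ncard ≤
      C * ∑ T ∈ S.powerset.filter (MutuallySingular f), codingCount f T n := by
  induction S using Finset.strongInduction with
  | H S ih =>
    by_cases hms : MutuallySingular f S
    · obtain ⟨C, hC⟩ := ncard_visitTimes_le_codingCount S hS
      refine ⟨C, fun n => (hC n).trans (Nat.mul_le_mul_left C ?_)⟩
      exact Finset.single_le_sum (f := fun T => codingCount f T n) (fun _ _ => Nat.zero_le _)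
        (Finset.mem_filter.2 ⟨Finset.mem_powerset_self S, hms⟩)
    · obtain ⟨C, hC⟩ := exists_ncard_visitTimes_le_of_not_mutuallySingular hms
      choose! D hD using fun (Z : Set M) (hZ : Z ∈ S) => ih (S.erase Z) (Finset.erase_ssubset hZ)
        fun Y hY => hS Y (Finset.mem_of_mem_erase hY)
      refine ⟨C * ∑ Z ∈ S, D Z, fun n => (hC n).trans ?_⟩
      rw [mul_assoc, Finset.sum_mul]
      refine Nat.mul_le_mul_left C (Finset.sum_le_sum fun Z hZ => (hD Z hZ n).trans ?_)
      refine Nat.mul_le_mul_left _ (Finset.sum_le_sum_of_subset ?_)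
      exact Finset.filter_subset_filter _ (Finset.powerset_mono.2 (Finset.erase_subset Z S))

/-! ### Generators are bounded by visit times -/

-- Points are labelled by the members of `F` they meet, one vector of visit times, and the point of
-- `Ω` they start near, if any. Equal labels give `ρ`-close orbits: at a visit time both lie in one
-- set of small diameter; at other times both are near points of `Ω`, which agree by induction on
-- time.
open Classical in
theorem minGenerator_le_sum_visitTimes {f : M → M} {Ω : Finset M} {F : Finset (Set M)}
    {ε η ρ r : ℝ} (hρε : ρ ≤ ε) (hrρ : 2 * r ≤ ρ) (hrη : 4 * r ≤ η) (hη : 0 < η)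
    (hΩ : ∀ p ∈ Ω, ∀ q ∈ Ω, p ≠ q → η ≤ dist p q)
    (hf : ∀ x y, dist x y < ρ → dist (f x) (f y) < η / 2)
    (hcover : ∀ x, (∃ Y ∈ F, x ∈ Y) ∨ ∃ q ∈ Ω, dist x q < r)
    (hF : ∀ Y ∈ F, IsWanderingSet f Y)
    (hdiam : ∀ Y ∈ F, ∀ x ∈ Y, ∀ y ∈ Y, dist x y < ρ) (n : ℕ+) :
    minGenerator f ε n ≤ (Ω.card + 1) * ∑ S ∈ F.powerset, (visitTimes f S n).ncard := by
  -- `dist p q < r + η / 2 + r ≤ η`, against the separation of `Ω`.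
  have hnear : ∀ p ∈ Ω, ∀ q ∈ Ω, ∀ x y, dist x p < r → dist y q < r → dist x y < η / 2 →
      p = q := by
    intro p hp q hq x y hxp hyq hxy
    by_contra hpq
    have := hΩ p hp q hq hpq
    have t1 := dist_triangle_left p q x
    have t2 := dist_triangle x y q
    linarith
  let A : Finset (Option M × Σ S : Finset (Set M), (S → Fin n)) :=
    (insert none (Ω.image some)) ×ˢ
      F.powerset.sigma fun S => (toFinite (visitTimes f S n)).toFinset
  have hAcard : A.card ≤ (Ω.card + 1) * ∑ S ∈ F.powerset, (visitTimes f S n).ncard := by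
    rw [Finset.card_product, Finset.card_sigma]
    refine Nat.mul_le_mul ((Finset.card_insert_le _ _).trans
      (Nat.add_le_add_right Finset.card_image_le 1)) (Finset.sum_le_sum fun S _ => ?_)
    rw [ncard_eq_toFinset_card _ (toFinite _)]
  refine (minGenerator_le_card A (fun x k => (∀ Y : k.2.1, f^[(k.2.2 Y : ℕ)] x ∈ (Y : Set M)) ∧
    k.2.1 ⊆ F ∧
    (∀ i < (n : ℕ), (∃ Y : k.2.1, (k.2.2 Y : ℕ) = i) ∨ ∃ q ∈ Ω, dist (f^[i] x) q < r) ∧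
    ∀ q ∈ Ω, dist x q < r → k.1 = some q) ?_ ?_).trans hAcard
  · intro x
    obtain ⟨p, hpA, hp⟩ : ∃ p ∈ insert none (Ω.image some),
        ∀ q ∈ Ω, dist x q < r → p = some q := by
      by_cases hx : ∃ q ∈ Ω, dist x q < r
      · obtain ⟨p, hp, hxp⟩ := hx
        exact ⟨some p, Finset.mem_insert_of_mem (Finset.mem_image_of_mem _ hp), fun q hq hxq =>
          congrArg some (hnear p hp q hq x x hxp hxq (by simpa using hη))⟩
      · exact ⟨none, Finset.mem_insert_self _ _, fun q hq hxq => (hx ⟨q, hq, hxq⟩).elim⟩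
    let S := F.filter fun Y => ∃ i : Fin n, f^[(i : ℕ)] x ∈ Y
    choose t ht using fun Y : S => (Finset.mem_filter.1 Y.2).2
    refine ⟨(p, ⟨S, t⟩), Finset.mem_product.2 ⟨hpA, Finset.mem_sigma.2
      ⟨Finset.mem_powerset.2 (Finset.filter_subset _ _), ?_⟩⟩, ht, Finset.filter_subset _ _, ?_, hp⟩
    · rw [Finite.mem_toFinset]
      exact ⟨x, ht⟩
    · intro i hi
      refine (hcover (f^[i] x)).imp_left fun ⟨Y, hY, hiY⟩ => ?_
      have hYS : Y ∈ S := Finset.mem_filter.2 ⟨hY, ⟨i, hi⟩, hiY⟩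
      exact ⟨⟨Y, hYS⟩, (hF Y hY).eq_of_mem (ht ⟨Y, hYS⟩) hiY⟩
  · rintro x y ⟨p, S, t⟩ ⟨hx, hSF, hxi, hxp⟩ ⟨hy, -, hyi, hyp⟩
    have hcell : ∀ i < (n : ℕ), (∀ p ∈ Ω, ∀ q ∈ Ω, dist (f^[i] x) p < r →
        dist (f^[i] y) q < r → p = q) → dist (f^[i] x) (f^[i] y) < ρ := by
      intro i hi hpq
      by_cases hY : ∃ Y : S, (t Y : ℕ) = i
      · obtain ⟨Y, rfl⟩ := hY
        exact hdiam Y (hSF Y.2) _ (hx Y) _ (hy Y)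
      · obtain ⟨p, hp, hxp'⟩ := (hxi i hi).resolve_left hY
        obtain ⟨q, hq, hyq⟩ := (hyi i hi).resolve_left hY
        obtain rfl := hpq p hp q hq hxp' hyq
        linarith [dist_triangle_right (f^[i] x) (f^[i] y) p]
    have key : ∀ i < (n : ℕ), dist (f^[i] x) (f^[i] y) < ρ := by
      intro i
      induction i with
      | zero =>
        refine fun hi => hcell 0 hi fun p' hp q hq hxp' hyq => ?_
        exact Option.some_injective _ ((hxp p' hp hxp').symm.trans (hyp q hq hyq))
      | succ i ih =>
        refine fun hi => hcell _ hi fun p' hp q hq hxp' hyq => ?_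
        refine hnear p' hp q hq _ _ hxp' hyq ?_
        rw [Function.iterate_succ_apply', Function.iterate_succ_apply']
        exact hf _ _ (ih (by omega))
    exact fun i hi => (key i hi).trans_le hρε

theorem exists_pos_le_dist_of_finite {Ω : Set M} (hΩ : Ω.Finite) :
    ∃ η > 0, ∀ p ∈ Ω, ∀ q ∈ Ω, p ≠ q → η ≤ dist p q := by
  by_cases h : Ω.Nontrivial
  · exact ⟨Ω.infsep, (hΩ.infsep_pos_iff_nontrivial).2 h, fun p hp q hq hpq =>
      infsep_le_dist_of_mem hp hq hpq⟩
  · exact ⟨1, one_pos, fun p hp q hq hpq => (h ⟨p, hp, q, hq, hpq⟩).elim⟩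

theorem exists_wandering_cover [CompactSpace M] (f : M → M) {K : Set M} (hK : IsCompact K)
    (hKΩ : ∀ x ∈ K, x ∉ nonwanderingSet f) {ρ : ℝ} (hρ : 0 < ρ) :
    ∃ F : Finset (Set M), (∀ x ∈ K, ∃ Y ∈ F, x ∈ Y) ∧ ∀ Y ∈ F,
      (Y.Nonempty ∧ Y ⊆ (nonwanderingSet f)ᶜ ∧ IsWanderingSet f Y ∧ IsCompactNeighborhood Y) ∧
      Metric.diam Y < ρ := by
  classical
  have hball : ∀ x, x ∉ nonwanderingSet f →
      ∃ s > 0, 2 * s < ρ ∧ IsWanderingSet f (Metric.ball x (2 * s)) := by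
    intro x hx
    obtain ⟨s, hs, h⟩ := exists_isWanderingSet_ball hx
    -- Half the wandering radius leaves room for the closure; `ρ / 4` makes the diameter less than
    -- `ρ`.
    refine ⟨min (s / 2) (ρ / 4), by positivity, ?_, h.mono (Metric.ball_subset_ball ?_)⟩
    · linarith [min_le_right (s / 2) (ρ / 4)]
    · linarith [min_le_left (s / 2) (ρ / 4)]
  choose! s hs hsρ hsw using hball
  obtain ⟨A, hAK, hA⟩ := hK.elim_nhds_subcover (fun x => Metric.ball x (s x))
    (fun x hx => Metric.ball_mem_nhds x (hs x (hKΩ x hx)))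
  refine ⟨A.image fun x => closure (Metric.ball x (s x)), fun x hx => ?_, fun Y hY => ?_⟩
  · obtain ⟨a, ha, hxa⟩ := mem_iUnion₂.1 (hA hx)
    exact ⟨_, Finset.mem_image_of_mem _ ha, subset_closure hxa⟩
  · obtain ⟨a, ha, rfl⟩ := Finset.mem_image.1 hY
    have haΩ := hKΩ a (hAK a ha)
    have hsub : closure (Metric.ball a (s a)) ⊆ Metric.ball a (2 * s a) :=
      Metric.closure_ball_subset_closedBall.trans
        (Metric.closedBall_subset_ball (by linarith [hs a haΩ]))
    refine ⟨⟨⟨a, subset_closure (Metric.mem_ball_self (hs a haΩ))⟩, hsub.trans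
      ((hsw a haΩ).subset_compl_nonwanderingSet Metric.isOpen_ball), (hsw a haΩ).mono hsub,
      isClosed_closure.isCompact, _, Metric.isOpen_ball, rfl⟩, ?_⟩
    rw [Metric.diam_closure]
    exact (Metric.diam_ball (hs a haΩ).le).trans_lt (hsρ a haΩ)

/-! ### The two inequalities -/

theorem growthClass_codingSeq_le_generalizedEntropy [CompactSpace M] {f : M ≃ₜ M}
    {F : Finset (Set M)} (hF : F ∈ singularFamilies f) :
    growthClass (codingSeq f F) ≤ generalizedEntropy f f.continuous := by
  obtain ⟨ε, hε, C, hC⟩ := exists_pos_codingCount_le f.continuous F fun Y hY =>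
    ⟨(hF.1 Y hY).2.1, (hF.1 Y hY).2.2.2.1⟩
  refine growthClass_le_of_le_sum {()} (fun _ => generatorSeq f f.continuous ε hε) C
    (fun n => ?_) fun _ _ => le_sSup ⟨ε, hε, rfl⟩
  rw [Finset.sum_singleton]
  change (codingCount f F n : ℝ≥0) ≤ C * (minGenerator f ε n : ℝ≥0)
  exact_mod_cast hC n

theorem exists_minGenerator_le_sum_codingCount [CompactSpace M] (f : M ≃ₜ M)
    (hf : (nonwanderingSet f).Finite) {ε δ : ℝ} (hε : 0 < ε) (hδ : 0 < δ) :
    ∃ J : Finset (Finset (Set M)), (∀ F ∈ J, F ∈ smallSingularFamilies f δ) ∧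
      ∃ C : ℕ, ∀ n, minGenerator f ε n ≤ C * ∑ F ∈ J, codingCount f F n := by
  classical
  obtain ⟨η, hη, hΩ⟩ := exists_pos_le_dist_of_finite hf
  obtain ⟨ρ₀, hρ₀, hfρ⟩ := Metric.uniformContinuous_iff.1
    (CompactSpace.uniformContinuous_of_continuous f.continuous) (η / 2) (half_pos hη)
  let ρ := min ρ₀ ε
  have hρ : 0 < ρ := lt_min hρ₀ hε
  let r := min (ρ / 2) (η / 4)
  have hr : 0 < r := by positivity
  -- `K` is what the `r`-balls around Ω(f) leave uncovered.
  have hK : IsCompact {x : M | ∀ q ∈ nonwanderingSet f, r ≤ dist x q} := by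
    refine IsClosed.isCompact ?_
    simp only [ofPred_forall]
    exact isClosed_biInter fun q _ => isClosed_le continuous_const (by fun_prop)
  obtain ⟨F, hFK, hF⟩ := exists_wandering_cover f hK (fun x hx hxΩ => by
    have := hx x hxΩ
    rw [dist_self] at this
    exact this.not_gt hr) (lt_min hρ hδ)
  choose! C hC using fun (S : Finset (Set M)) (hS : S ∈ F.powerset) =>
    exists_ncard_visitTimes_le_sum_codingCount (f := f) S
      fun Y hY => (hF Y (Finset.mem_powerset.1 hS hY)).1.2.2.1
  refine ⟨F.powerset.filter (MutuallySingular f), fun S hS => ?_,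
    (hf.toFinset.card + 1) * ∑ S ∈ F.powerset, C S, fun n => ?_⟩
  · obtain ⟨hSF, hms⟩ := Finset.mem_filter.1 hS
    have hSF := Finset.mem_powerset.1 hSF
    exact ⟨⟨fun Y hY => (hF Y (hSF hY)).1, hms⟩, fun Y hY =>
      (hF Y (hSF hY)).2.trans_le (min_le_right _ _)⟩
  · refine (minGenerator_le_sum_visitTimes (Ω := hf.toFinset) (F := F) (η := η) (ρ := ρ) (r := r)
      (min_le_right _ _) (by linarith [min_le_left (ρ / 2) (η / 4)])
      (by linarith [min_le_right (ρ / 2) (η / 4)]) hη (by simpa using hΩ)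
      (fun x y hxy => hfρ (hxy.trans_le (min_le_left _ _))) (fun x => ?_)
      (fun Y hY => (hF Y hY).1.2.2.1) (fun Y hY x hx y hy => ?_) n).trans ?_
    · by_cases hx : ∀ q ∈ nonwanderingSet f, r ≤ dist x q
      · exact .inl (hFK x hx)
      · push Not at hx
        simpa using Or.inr hx
    · exact (Metric.dist_le_diam_of_mem (hF Y hY).1.2.2.2.1.isBounded hx hy).trans_lt
        ((hF Y hY).2.trans_le (min_le_left _ _))
    · rw [mul_assoc, Finset.sum_mul]
      refine Nat.mul_le_mul_left _ (Finset.sum_le_sum fun S hS => (hC S hS n).trans ?_)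
      refine Nat.mul_le_mul_left _ (Finset.sum_le_sum_of_subset ?_)
      exact Finset.filter_subset_filter _ (Finset.powerset_mono.2 (Finset.mem_powerset.1 hS))

theorem generalizedEntropy_le_sSup_smallSingularFamilies [CompactSpace M] (f : M ≃ₜ M)
    (hf : (nonwanderingSet f).Finite) {δ : ℝ} (hδ : 0 < δ) :
    generalizedEntropy f f.continuous ≤
      sSup {o | ∃ F ∈ smallSingularFamilies f δ, o = growthClass (codingSeq f F)} := by
  refine sSup_le ?_
  rintro _ ⟨ε, hε, rfl⟩
  obtain ⟨J, hJ, C, hC⟩ := exists_minGenerator_le_sum_codingCount f hf hε hδ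
  refine growthClass_le_of_le_sum J (codingSeq f) C (fun n => ?_)
    fun F hF => le_sSup ⟨F, hJ F hF, rfl⟩
  have := hC n
  change (minGenerator f ε n : ℝ≥0) ≤ C * ∑ F ∈ J, (codingCount f F n : ℝ≥0)
  exact_mod_cast this

end Wandering

theorem theoremB {M : Type*} [MetricSpace M] [CompactSpace M] (f : M ≃ₜ M)
    (hf : (nonwanderingSet f).Finite) :
    generalizedEntropy f f.continuous =
        sSup {o | ∃ F ∈ singularFamilies f, o = growthClass (codingSeq f F)} ∧
      ∀ δ : ℝ, 0 < δ →
        generalizedEntropy f f.continuous =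
          sSup {o | ∃ F ∈ smallSingularFamilies f δ, o = growthClass (codingSeq f F)} := by
  have hle : sSup {o | ∃ F ∈ singularFamilies f, o = growthClass (codingSeq f F)} ≤
      generalizedEntropy f f.continuous := by
    refine sSup_le ?_
    rintro _ ⟨F, hF, rfl⟩
    exact growthClass_codingSeq_le_generalizedEntropy hF
  have hmono : ∀ δ : ℝ,
      sSup {o | ∃ F ∈ smallSingularFamilies f δ, o = growthClass (codingSeq f F)} ≤
        sSup {o | ∃ F ∈ singularFamilies f, o = growthClass (codingSeq f F)} := fun δ =>
    sSup_le_sSup fun _ ⟨F, hF, ho⟩ => ⟨F, hF.1, ho⟩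
  have hge := fun {δ : ℝ} (hδ : 0 < δ) => generalizedEntropy_le_sSup_smallSingularFamilies f hf hδ
  -- The cycle is o(f) ≤ sup over Σ_δ ≤ sup over Σ ≤ o(f); any δ, here 1, serves for the first
  -- equality.
  exact ⟨((hge one_pos).trans (hmono 1)).antisymm hle, fun δ hδ =>
    (hge hδ).antisymm ((hmono δ).trans hle)⟩
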